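/- Let $p$ be an odd prime. A group $P$ is called capable if $P\cong M/Z(M)$ for some group $M$. Let $G$ and $K$ be nonabelian groups, nilpotent of class two and of exponent $p$. Let $H$ be a nontrivial subgroup of $[G,G]$, and let $\phi\colon H\to[K,K]$ be an injective homomorphism. Let $F=G*K$ be the free product, let $G\amalg^{\mathfrak N_2}K=F/[[F,F],F]$ be the $2$-nilpotent product of $G$ and $K$, and let $$G\amalg_\phi^{\mathfrak N_2}K=\frac{G\amalg^{\mathfrak N_2}K}{\{\,h\,\phi(h)^{-1} : h\in H\,\}}$$ be the amalgamated coproduct of $G$ and $K$ along $\phi$, where $h$ and $\phi(h)$ are identified with their images in $G\amalg^{\mathfrak N_2}K$ (the set in the denominator is a central subgroup). If $G$ is capable or $K$ is capable, then $G\amalg_\phi^{\mathfrak N_2}K$ is capable. -/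

import Mathlib

universe u v

/-- A group `G` is capable if it is isomorphic to `H ⧸ Z(H)` for some group `H`. (Replacing `H` by
the subgroup generated by lifts of the elements of `G` shows that the universe of `H` is no
restriction.) -/
def Capable (G : Type u) [Group G] : Prop :=
  ∃ (H : Type u) (_ : Group H), Nonempty (G ≃* H ⧸ Subgroup.center H)

/-- `G` is nilpotent of class at most two: the third term `[[G, G], G]` of its lower central
series is trivial. (Mathlib numbers the lower central series from zero.) -/
def ClassAtMostTwo (G : Type u) [Group G] : Prop :=
  (⊤ : Subgroup G).lowerCentralSeries 2 = ⊥

/-- The `2`-nilpotent product of `A` and `B`: the quotient of the free product `F = A * B` by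
the third term `[[F, F], F]` of its lower central series. -/
abbrev TwoNilpotentProduct (A : Type u) (B : Type v) [Group A] [Group B] : Type (max u v) :=
  Monoid.Coprod A B ⧸ (⊤ : Subgroup (Monoid.Coprod A B)).lowerCentralSeries 2

namespace TwoNilpotentProduct

/-- The canonical map from the first factor. -/
def inl (A : Type u) (B : Type v) [Group A] [Group B] : A →* TwoNilpotentProduct A B :=
  (QuotientGroup.mk' _).comp Monoid.Coprod.inl

/-- The canonical map from the second factor. -/
def inr (A : Type u) (B : Type v) [Group A] [Group B] : B →* TwoNilpotentProduct A B :=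
  (QuotientGroup.mk' _).comp Monoid.Coprod.inr

theorem commutator_le_center (A : Type u) (B : Type v) [Group A] [Group B] :
    commutator (TwoNilpotentProduct A B) ≤ Subgroup.center (TwoNilpotentProduct A B) := by
  rw [← Subgroup.commutator_top_right_eq_bot_iff_le_center]
  change (⊤ : Subgroup (TwoNilpotentProduct A B)).lowerCentralSeries 2 = ⊥
  have hs : Function.Surjective (QuotientGroup.mk'
      ((⊤ : Subgroup (Monoid.Coprod A B)).lowerCentralSeries 2)) :=
    QuotientGroup.mk'_surjective _
  rw [← Subgroup.map_top_of_surjective _ hs, ← Subgroup.map_lowerCentralSeries]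
  exact (Subgroup.map_eq_bot_iff _).2 (by rw [QuotientGroup.ker_mk'])

end TwoNilpotentProduct

/-- The set of all `h φ(h)⁻¹`, `h ∈ H`, in the `2`-nilpotent product of `G` and `K`. -/
def amalgamSet {G : Type u} {K : Type v} [Group G] [Group K] (H : Subgroup G)
    (φ : H →* commutator K) : Set (TwoNilpotentProduct G K) :=
  {x | ∃ h : H, x = TwoNilpotentProduct.inl G K (h : G) *
    (TwoNilpotentProduct.inr G K (φ h : K))⁻¹}

/-- The amalgamated coproduct of `G` and `K` along `φ : H → [K, K]`: the quotient of the
`2`-nilpotent product by the (normal subgroup generated by the) elements `h φ(h)⁻¹`. When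
`H ≤ [G, G]` these elements already form a normal subgroup, see `coe_normalClosure_amalgamSet`. -/
abbrev AmalgamatedCoproduct {G : Type u} {K : Type v} [Group G] [Group K] (H : Subgroup G)
    (φ : H →* commutator K) : Type (max u v) :=
  TwoNilpotentProduct G K ⧸ Subgroup.normalClosure (amalgamSet H φ)

theorem coe_normalClosure_amalgamSet {G : Type u} {K : Type v} [Group G] [Group K]
    (H : Subgroup G) (hH : H ≤ commutator G) (φ : H →* commutator K) :
    (Subgroup.normalClosure (amalgamSet H φ) : Set (TwoNilpotentProduct G K)) =
      amalgamSet H φ := by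
  have hl : ∀ h : H, TwoNilpotentProduct.inl G K (h : G) ∈
      Subgroup.center (TwoNilpotentProduct G K) := fun h =>
    TwoNilpotentProduct.commutator_le_center G K
      ((Subgroup.map_commutator _ _ _).le.trans (Subgroup.commutator_mono le_top le_top)
        (Subgroup.mem_map_of_mem (TwoNilpotentProduct.inl G K) (hH h.2)))
  have hr : ∀ h : H, (TwoNilpotentProduct.inr G K (φ h : K))⁻¹ ∈
      Subgroup.center (TwoNilpotentProduct G K) := fun h =>
    inv_mem (TwoNilpotentProduct.commutator_le_center G K
      ((Subgroup.map_commutator _ _ _).le.trans (Subgroup.commutator_mono le_top le_top)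
        (Subgroup.mem_map_of_mem (TwoNilpotentProduct.inr G K) (φ h).2)))
  let N : Subgroup (TwoNilpotentProduct G K) :=
    { carrier := amalgamSet H φ
      one_mem' := ⟨1, by simp⟩
      mul_mem' := by
        rintro _ _ ⟨a, rfl⟩ ⟨b, rfl⟩
        refine ⟨a * b, ?_⟩
        have h1 := Subgroup.mem_center_iff.1 (hr a)
        have h2 := Subgroup.mem_center_iff.1 (hr b)
        simp only [Subgroup.coe_mul, map_mul, mul_inv_rev]
        rw [mul_assoc, ← mul_assoc _ _ (_)⁻¹, ← h1, mul_assoc, mul_assoc, h2]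
      inv_mem' := by
        rintro _ ⟨a, rfl⟩
        refine ⟨a⁻¹, ?_⟩
        have h1 := Subgroup.mem_center_iff.1 (inv_mem (hl a))
        simp only [mul_inv_rev, inv_inv, InvMemClass.coe_inv, map_inv]
        exact h1 _ }
  have hN : N.Normal := ⟨by
    rintro _ ⟨h, rfl⟩ g
    rw [Subgroup.mem_center_iff.1 (mul_mem (hl h) (hr h)) g, mul_inv_cancel_right]
    exact ⟨h, rfl⟩⟩
  exact subset_antisymm (Subgroup.normalClosure_le_normal (N := N) subset_rfl)
    Subgroup.subset_normalClosure

/-!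
Let `P` be the amalgam and `a : H → G`, `b : H → K` the two embeddings of the amalgamated subgroup.
`P` is capable once its epicentre is trivial, and whenever `P` maps to `W / Z(W)`, a lift to `W` of
an element of the epicentre commutes with all lifts of elements of the image of `P`.

The groups `W` are generated by `K` and a copy of a central extension `L` of `G` inside a wreath
product of a group `A` by `K`, where `l` acts at the coordinate `x ∈ K` through `α(l) T(x)(l)`, with
`α : L → A` a homomorphism, `T(x)` a character of `G` with central values, and `T` quadratic in
`x`. Because `T` is quadratic, `W / Z(W)` has class two. The map from `P` exists as soon as
`T(b(h))` is the character `⁅α(a(h)), α(·)⁆`.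

* For `L = G`, `α = 1` and `T(x) = f · f'(x)²`, with linear functionals `f` and `f'` on the
  abelianizations, centrality confines the epicentre to `[G, G] [K, K]`.
* If `G = L / Z(L)` and `α = id`, then centrality of the image of `g k` forces
  `T(k) = ⁅g, ·⁆⁻¹`. For odd `p` the Baer addition turns `K` into a vector space over `𝔽_p`, so
  linear maps on it provide quadratic maps `T` with prescribed values on `b(H)` and at one further
  point. Hence `k = b(h)` for some `h`, and then `g a(h) = 1`.
-/

universe w

open scoped commutatorElement IsMulCommutative TensorProduct

section Commutators

variable {A B Q : Type*} [Group A] [Group B] [Group Q]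

theorem mul_eq_commutatorElement_mul (x y : Q) : x * y = ⁅x, y⁆ * (y * x) := by
  simp [commutatorElement_def, mul_assoc]

theorem commutatorElement_mul_left_of_mem_center {x y z : Q} (h : ⁅y, z⁆ ∈ Subgroup.center Q) :
    ⁅x * y, z⁆ = ⁅x, z⁆ * ⁅y, z⁆ := by
  rw [commutatorElement_mul_left_eq_conj_mul, Subgroup.mem_center_iff.1 h x,
    mul_inv_cancel_right, Subgroup.mem_center_iff.1 h]

theorem commutatorElement_mul_right_of_mem_center {x y z : Q} (h : ⁅x, z⁆ ∈ Subgroup.center Q) :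
    ⁅x, y * z⁆ = ⁅x, y⁆ * ⁅x, z⁆ := by
  rw [commutatorElement_mul_right_eq_mul_conj, mul_assoc, mul_assoc, ← mul_assoc y,
    Subgroup.mem_center_iff.1 h y, mul_inv_cancel_right]

theorem commutatorElement_eq_one_of_left_mem_center {x : Q} (hx : x ∈ Subgroup.center Q) (y : Q) :
    ⁅x, y⁆ = 1 :=
  commutatorElement_eq_one_iff_mul_comm.2 (Subgroup.mem_center_iff.1 hx y).symm

theorem commutatorElement_eq_one_of_right_mem_center {y : Q} (hy : y ∈ Subgroup.center Q) (x : Q) :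
    ⁅x, y⁆ = 1 :=
  commutatorElement_eq_one_iff_mul_comm.2 (Subgroup.mem_center_iff.1 hy x)

theorem commute_mk_iff {N : Subgroup Q} [N.Normal] {x y : Q} :
    Commute (x : Q ⧸ N) y ↔ ⁅x, y⁆ ∈ N := by
  rw [← QuotientGroup.eq_one_iff, ← commutatorElement_eq_one_iff_commute]
  rfl

theorem commute_mk_commutatorElement_iff {N : Subgroup Q} [N.Normal] {x y z : Q} :
    Commute (x : Q ⧸ N) ⁅(y : Q ⧸ N), (z : Q ⧸ N)⁆ ↔ ⁅x, ⁅y, z⁆⁆ ∈ N :=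
  commute_mk_iff (y := ⁅y, z⁆)

theorem mem_center_of_closure_eq_top {S : Set Q} (hS : Subgroup.closure S = ⊤) {z : Q}
    (hz : ∀ s ∈ S, Commute s z) : z ∈ Subgroup.center Q := by
  rwa [← Subgroup.centralizer_univ, ← Subgroup.coe_top, ← hS, Subgroup.centralizer_closure,
    Subgroup.mem_centralizer_iff]

/-- The pairing `(a, b) ↦ ⁅f a, g b⁆`, multiplicative in each variable because its values are
central. -/
def commutatorPairing (f : A →* Q) (g : B →* Q) (h : ∀ a b, ⁅f a, g b⁆ ∈ Subgroup.center Q) :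
    A →* B →* Subgroup.center Q :=
  MonoidHom.mk' (fun a => MonoidHom.mk' (fun b => ⟨⁅f a, g b⁆, h a b⟩) fun b₁ b₂ =>
      Subtype.ext (by simpa using commutatorElement_mul_right_of_mem_center (h a b₂)))
    fun a₁ a₂ => by
      ext b
      simpa using commutatorElement_mul_left_of_mem_center (h a₂ b)

theorem coe_commutatorPairing (f : A →* Q) (g : B →* Q)
    (h : ∀ a b, ⁅f a, g b⁆ ∈ Subgroup.center Q) (a : A) (b : B) :
    (commutatorPairing f g h a b : Q) = ⁅f a, g b⁆ := rfl

end Commutators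

namespace ClassAtMostTwo

variable {G : Type u} [Group G]

theorem iff_commutator_le_center : ClassAtMostTwo G ↔ commutator G ≤ Subgroup.center G :=
  Subgroup.commutator_top_right_eq_bot_iff_le_center

theorem commutator_le_center (h : ClassAtMostTwo G) : commutator G ≤ Subgroup.center G :=
  iff_commutator_le_center.1 h

theorem commutatorElement_mem_center (h : ClassAtMostTwo G) (x y : G) :
    ⁅x, y⁆ ∈ Subgroup.center G :=
  h.commutator_le_center (Subgroup.commutator_mem_commutator trivial trivial)

theorem commutator_ne_top (h : ClassAtMostTwo G) (h₁ : commutator G ≠ ⊥) : commutator G ≠ ⊤ :=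
  fun htop => h₁ <| (commutator_eq_bot_iff_center_eq_top G).2 <|
    top_le_iff.1 (htop ▸ h.commutator_le_center)

theorem of_closure_eq_top {S : Set G} (hS : Subgroup.closure S = ⊤)
    (h : ∀ x ∈ S, ∀ y ∈ S, ⁅x, y⁆ ∈ Subgroup.center G) : ClassAtMostTwo G := by
  have commute_mk : ∀ x y : G, Commute (x : G ⧸ Subgroup.center G) y := fun x y =>
    Subgroup.closure_induction₂ (p := fun (x y : G) _ _ => Commute (x : G ⧸ Subgroup.center G) y)
      (fun x y hx hy => commute_mk_iff.2 (h x hx y hy))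
      (fun x _ => Commute.one_left _) (fun x _ => Commute.one_right _)
      (fun _ _ _ _ _ _ h₁ h₂ => h₁.mul_left h₂) (fun _ _ _ _ _ _ h₁ h₂ => h₁.mul_right h₂)
      (fun _ _ _ _ h => h.inv_left) (fun _ _ _ _ h => h.inv_right)
      (hS ▸ Subgroup.mem_top x) (hS ▸ Subgroup.mem_top y)
  rw [iff_commutator_le_center, commutator_def, Subgroup.commutator_le]
  exact fun x _ y _ => commute_mk_iff.1 (commute_mk x y)

theorem of_closure_range_union_range {G₁ : Type v} {G₂ : Type w} [Group G₁] [Group G₂]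
    (h₁ : ClassAtMostTwo G₁) (h₂ : ClassAtMostTwo G₂) {f₁ : G₁ →* G} {f₂ : G₂ →* G}
    (hgen : Subgroup.closure (Set.range f₁ ∪ Set.range f₂) = ⊤)
    (hc : ∀ x y, ⁅f₁ x, f₂ y⁆ ∈ Subgroup.center G) : ClassAtMostTwo G := by
  have pairing_left {x y} (hx : x ∈ commutator G₁) : Commute (f₁ x) (f₂ y) := by
    rw [← commutatorElement_eq_one_iff_commute, ← coe_commutatorPairing f₁ f₂ hc,
      Abelianization.commutator_subset_ker (commutatorPairing f₁ f₂ hc) hx]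
    rfl
  have pairing_right {x y} (hy : y ∈ commutator G₂) : Commute (f₁ x) (f₂ y) := by
    rw [← commutatorElement_eq_one_iff_commute, ← coe_commutatorPairing f₁ f₂ hc,
      Abelianization.commutator_subset_ker (commutatorPairing f₁ f₂ hc x) hy]
    rfl
  have mem_center {z : G} (hz₁ : ∀ x, Commute (f₁ x) z) (hz₂ : ∀ y, Commute (f₂ y) z) :
      z ∈ Subgroup.center G := mem_center_of_closure_eq_top hgen <| by
    rintro _ (⟨x, rfl⟩ | ⟨y, rfl⟩)
    exacts [hz₁ x, hz₂ y]
  refine of_closure_eq_top hgen ?_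
  rintro _ (⟨x, rfl⟩ | ⟨y, rfl⟩) _ (⟨x', rfl⟩ | ⟨y', rfl⟩)
  · rw [← map_commutatorElement]
    exact mem_center
      (fun g => Commute.map (Subgroup.mem_center_iff.1 (h₁.commutatorElement_mem_center x x') g) f₁)
      fun _ => (pairing_left (Subgroup.commutator_mem_commutator trivial trivial)).symm
  · exact hc x y'
  · rw [← commutatorElement_inv]
    exact inv_mem (hc x' y)
  · rw [← map_commutatorElement]
    exact mem_center (fun _ => pairing_right (Subgroup.commutator_mem_commutator trivial trivial))
      fun k => Commute.map (Subgroup.mem_center_iff.1 (h₂.commutatorElement_mem_center y y') k) f₂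

end ClassAtMostTwo

section CentralKernel

variable {F W : Type*} [Group F] [Group W] {ρ : F →* W}

/-- The preimage under `ρ : F → W` of the centre of the image of `ρ`. The quotient
`F ⧸ centralKernel ρ` is the central quotient of `ρ.range`. -/
def centralKernel (ρ : F →* W) : Subgroup F :=
  (Subgroup.center ρ.range).comap ρ.rangeRestrict

instance : (centralKernel ρ).Normal :=
  inferInstanceAs ((Subgroup.center ρ.range).comap ρ.rangeRestrict).Normal

theorem mem_centralKernel {w : F} : w ∈ centralKernel ρ ↔ ∀ x, Commute (ρ w) (ρ x) := by
  rw [centralKernel, Subgroup.mem_comap, Subgroup.mem_center_iff, ρ.rangeRestrict_surjective.forall]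
  exact forall_congr' fun x => Subtype.ext_iff.trans eq_comm

theorem mem_centralKernel_of_mem_center {w : F} (hw : ρ w ∈ Subgroup.center W) :
    w ∈ centralKernel ρ :=
  mem_centralKernel.2 fun x => (Subgroup.mem_center_iff.1 hw (ρ x)).symm

theorem commute_of_mk_eq {x y t : F} (h : (x : F ⧸ centralKernel ρ) = y)
    (hx : Commute (ρ x) (ρ t)) : Commute (ρ y) (ρ t) := by
  have := hx.mul_left (mem_centralKernel.1 (QuotientGroup.eq.1 h) t)
  rwa [← map_mul, mul_inv_cancel_left] at this

end CentralKernel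

/-- The Beyl–Felgner–Schmid epicentre of `P`, for the free presentation of `P` on its elements:
with `R` the subgroup of relations, it is the image in `P` of the centre of `F ⧸ [R, F]`. -/
def epicenter (P : Type u) [Group P] : Subgroup P :=
  (centralKernel (QuotientGroup.mk' ⁅(FreeGroup.lift (id : P → P)).ker, ⊤⁆)).map
    (FreeGroup.lift id)

theorem Capable.of_surjective {M P : Type u} [Group M] [Group P] {q : M →* P}
    (hq : Function.Surjective q) (hker : q.ker = Subgroup.center M) : Capable P :=
  ⟨M, inferInstance, ⟨((QuotientGroup.quotientMulEquivOfEq hker.symm).trans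
    (QuotientGroup.quotientKerEquivOfSurjective q hq)).symm⟩⟩

theorem Capable.of_epicenter_eq_bot {P : Type u} [Group P] (h : epicenter P = ⊥) : Capable P := by
  let ε : FreeGroup P →* P := FreeGroup.lift id
  let q : FreeGroup P ⧸ ⁅ε.ker, ⊤⁆ →* P := QuotientGroup.lift _ ε (Subgroup.commutator_le_left _ _)
  have hq : Function.Surjective q := fun x => ⟨(FreeGroup.of x : FreeGroup P), by simp [q, ε]⟩
  refine Capable.of_surjective hq (le_antisymm ?_ ?_)
  · rintro ⟨r⟩ hr
    refine Subgroup.mem_center_iff.2 ?_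
    rintro ⟨w⟩
    refine commutatorElement_eq_one_iff_mul_comm.1 ?_ |>.symm
    exact (QuotientGroup.eq_one_iff _).2 (Subgroup.commutator_mem_commutator hr trivial)
  · rintro ⟨w⟩ hw
    refine Subgroup.mem_bot.1 (h ▸ Subgroup.mem_map_of_mem ε (mem_centralKernel.2 fun x => ?_))
    exact (Subgroup.mem_center_iff.1 hw _).symm

theorem commute_of_mem_epicenter {P F W : Type*} [Group P] [Group F] [Group W] {ρ : F →* W}
    (Ψ : P →* F ⧸ centralKernel ρ) {z z' : P} {w w' : F} (hz : z ∈ epicenter P)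
    (hw : Ψ z = w) (hw' : Ψ z' = w') : Commute (ρ w) (ρ w') := by
  let ε : FreeGroup P →* P := FreeGroup.lift id
  obtain ⟨s, hs⟩ := (QuotientGroup.mk_surjective (s := centralKernel ρ)).hasRightInverse
  let σ : FreeGroup P →* F := FreeGroup.lift (s ∘ Ψ)
  have mk_σ : ∀ r, (σ r : F ⧸ centralKernel ρ) = Ψ (ε r) := DFunLike.congr_fun <|
    show (QuotientGroup.mk' _).comp σ = Ψ.comp ε by ext x; simp [σ, ε, hs (Ψ x)]
  have relators_le : ⁅ε.ker, ⊤⁆ ≤ (ρ.comp σ).ker := Subgroup.commutator_le.2 fun r hr x _ => by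
    have : σ r ∈ centralKernel ρ := by
      rw [← QuotientGroup.eq_one_iff, mk_σ, MonoidHom.mem_ker.1 hr, map_one]
    rw [MonoidHom.mem_ker, map_commutatorElement, commutatorElement_eq_one_iff_commute]
    exact mem_centralKernel.1 this (σ x)
  obtain ⟨r, hr, rfl⟩ := hz
  obtain ⟨r', rfl⟩ : ∃ r', ε r' = z' := ⟨FreeGroup.of z', by simp [ε]⟩
  have commute_σ : Commute (ρ (σ r)) (ρ (σ r')) := by
    have := mem_centralKernel.1 hr r'
    rw [← commutatorElement_eq_one_iff_commute, ← map_commutatorElement] at this ⊢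
    rw [← map_commutatorElement]
    exact relators_le ((QuotientGroup.eq_one_iff _).1 this)
  exact (commute_of_mk_eq ((mk_σ r').trans hw')
    (commute_of_mk_eq ((mk_σ r).trans hw) commute_σ).symm).symm

/-- A map from a group `K` to an abelian group `V` whose deviation from multiplicativity is a
pairing `polar`. Both a character square and a homomorphism for the Baer addition of `K` are of
this kind. -/
structure QuadraticHom (K V : Type*) [Group K] [CommGroup V] where
  toFun : K → V
  polar : K →* K →* V
  map_mul' : ∀ x y, toFun (x * y) = toFun x * toFun y * polar x y

namespace QuadraticHom

variable {K V : Type*} [Group K] [CommGroup V]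

instance : CoeFun (QuadraticHom K V) fun _ => K → V := ⟨toFun⟩

protected theorem map_mul (T : QuadraticHom K V) (x y : K) : T (x * y) = T x * T y * T.polar x y :=
  T.map_mul' x y

@[simp]
protected theorem map_one (T : QuadraticHom K V) : T 1 = 1 := by
  simpa using T.map_mul 1 1

/-- The quadratic map `k ↦ (g ↦ f g * (f' k) ^ 2)` attached to two characters with values in the
additive group of a commutative ring. -/
def ofCharacters {G R : Type*} [Group G] [CommRing R] (f : G →* Multiplicative R)
    (f' : K →* Multiplicative R) : QuadraticHom K (G →* Multiplicative R) where
  toFun k := (AddMonoidHom.mulRight ((f' k).toAdd ^ 2)).toMultiplicative.comp f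
  polar := MonoidHom.mk' (fun x => MonoidHom.mk' (fun y =>
      (AddMonoidHom.mulRight (2 * (f' x).toAdd * (f' y).toAdd)).toMultiplicative.comp f)
      fun y y' => by
        ext g
        change (f g).toAdd * (2 * (f' x).toAdd * (f' (y * y')).toAdd) =
          (f g).toAdd * (2 * (f' x).toAdd * (f' y).toAdd) +
            (f g).toAdd * (2 * (f' x).toAdd * (f' y').toAdd)
        rw [map_mul, toAdd_mul]
        ring)
      fun x x' => by
        ext y g
        change (f g).toAdd * (2 * (f' (x * x')).toAdd * (f' y).toAdd) =
          (f g).toAdd * (2 * (f' x).toAdd * (f' y).toAdd) +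
            (f g).toAdd * (2 * (f' x').toAdd * (f' y).toAdd)
        rw [map_mul, toAdd_mul]
        ring
  map_mul' x y := by
    ext g
    change (f g).toAdd * (f' (x * y)).toAdd ^ 2 =
      (f g).toAdd * (f' x).toAdd ^ 2 + (f g).toAdd * (f' y).toAdd ^ 2 +
        (f g).toAdd * (2 * (f' x).toAdd * (f' y).toAdd)
    rw [map_mul, toAdd_mul]
    ring

end QuadraticHom

/-- The type synonym of `K` carrying the Baer addition `x + y = x y ⁅x, y⁆ ^ d`, which makes `K`
an abelian group when `K` has class two and its commutators have order dividing `2 d + 1`. -/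
def BaerGroup {K : Type u} [Group K] {d : ℕ} (_ : ClassAtMostTwo K)
    (_ : ∀ x y : K, ⁅x, y⁆ ^ (2 * d + 1) = 1) : Type u := K

namespace BaerGroup

variable {K : Type u} [Group K] {d : ℕ} {hK : ClassAtMostTwo K}
  {hd : ∀ x y : K, ⁅x, y⁆ ^ (2 * d + 1) = 1}

/-- The identification of `K` with its Baer group. -/
def of : K ≃ BaerGroup hK hd := Equiv.refl K

theorem mul_mul_commutator_pow_assoc (hK : ClassAtMostTwo K) (d : ℕ) (x y z : K) :
    x * y * ⁅x, y⁆ ^ d * z * ⁅x * y * ⁅x, y⁆ ^ d, z⁆ ^ d =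
      x * (y * z * ⁅y, z⁆ ^ d) * ⁅x, y * z * ⁅y, z⁆ ^ d⁆ ^ d := by
  have hc := hK.commutatorElement_mem_center
  have hcd : ∀ x y : K, ⁅x, y⁆ ^ d ∈ Subgroup.center K := fun x y => pow_mem (hc x y) d
  have hxy := Subgroup.mem_center_iff.1 (hcd x y)
  have left : ⁅x * y * ⁅x, y⁆ ^ d, z⁆ ^ d = ⁅x, z⁆ ^ d * ⁅y, z⁆ ^ d := by
    rw [commutatorElement_mul_left_of_mem_center (hc _ z),
      commutatorElement_eq_one_of_left_mem_center (hcd x y), mul_one,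
      commutatorElement_mul_left_of_mem_center (hc y z),
      Commute.mul_pow (Subgroup.mem_center_iff.1 (hc y z) _)]
  have right : ⁅x, y * z * ⁅y, z⁆ ^ d⁆ ^ d = ⁅x, y⁆ ^ d * ⁅x, z⁆ ^ d := by
    rw [commutatorElement_mul_right_of_mem_center (hc x _),
      commutatorElement_eq_one_of_right_mem_center (hcd y z), mul_one,
      commutatorElement_mul_right_of_mem_center (hc x z),
      Commute.mul_pow (Subgroup.mem_center_iff.1 (hc x z) _)]
  rw [left, right]
  calc x * y * ⁅x, y⁆ ^ d * z * (⁅x, z⁆ ^ d * ⁅y, z⁆ ^ d)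
      = x * y * (⁅x, y⁆ ^ d * z) * (⁅x, z⁆ ^ d * ⁅y, z⁆ ^ d) := by group
    _ = x * y * z * (⁅x, y⁆ ^ d * ⁅x, z⁆ ^ d * ⁅y, z⁆ ^ d) := by rw [← hxy]; group
    _ = x * y * z * (⁅y, z⁆ ^ d * (⁅x, y⁆ ^ d * ⁅x, z⁆ ^ d)) := by
      rw [Subgroup.mem_center_iff.1 (hcd y z)]
    _ = x * (y * z * ⁅y, z⁆ ^ d) * (⁅x, y⁆ ^ d * ⁅x, z⁆ ^ d) := by group

theorem mul_mul_commutator_pow_comm (hK : ClassAtMostTwo K)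
    (hd : ∀ x y : K, ⁅x, y⁆ ^ (2 * d + 1) = 1) (x y : K) :
    x * y * ⁅x, y⁆ ^ d = y * x * ⁅y, x⁆ ^ d := by
  have inv_pow : ⁅x, y⁆ * ⁅x, y⁆ ^ d = ⁅y, x⁆ ^ d := by
    rw [← pow_succ', ← commutatorElement_inv x y, inv_pow, eq_inv_iff_mul_eq_one, ← pow_add,
      show d + 1 + d = 2 * d + 1 by omega, hd]
  rw [mul_eq_commutatorElement_mul x y,
    ← Subgroup.mem_center_iff.1 (hK.commutatorElement_mem_center x y), mul_assoc, inv_pow]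

instance : AddCommGroup (BaerGroup hK hd) :=
  letI : Add (BaerGroup hK hd) :=
    ⟨fun x y => of (of.symm x * of.symm y * ⁅of.symm x, of.symm y⁆ ^ d)⟩
  letI : Zero (BaerGroup hK hd) := ⟨of 1⟩
  letI : Neg (BaerGroup hK hd) := ⟨fun x => of (of.symm x)⁻¹⟩
  { AddGroup.ofLeftAxioms (G := BaerGroup hK hd) (mul_mul_commutator_pow_assoc (K := K) hK d)
      (fun x => show 1 * of.symm x * ⁅1, of.symm x⁆ ^ d = of.symm x by simp)
      (fun x => show (of.symm x)⁻¹ * of.symm x * ⁅(of.symm x)⁻¹, of.symm x⁆ ^ d = 1 by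
        simp [commutatorElement_def]) with
    add_comm := mul_mul_commutator_pow_comm (K := K) hK hd }

theorem of_add_of (x y : K) : (of x + of y : BaerGroup hK hd) = of (x * y * ⁅x, y⁆ ^ d) := rfl

theorem of_mul_of_commute {x y : K} (h : Commute x y) :
    (of (x * y) : BaerGroup hK hd) = of x + of y := by
  rw [of_add_of, commutatorElement_eq_one_iff_commute.2 h, one_pow, mul_one]

theorem of_pow (x : K) (n : ℕ) : (of (x ^ n) : BaerGroup hK hd) = n • of x := by
  induction n with
  | zero => rw [pow_zero, zero_nsmul]; rfl
  | succ n ih => rw [pow_succ, succ_nsmul, ← ih, of_mul_of_commute (Commute.pow_self x n)]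

theorem of_mul (x y : K) :
    (of (x * y) : BaerGroup hK hd) = of x + of y - d • of ⁅x, y⁆ := by
  rw [eq_sub_iff_add_eq, ← of_pow, of_add_of x y, ← of_mul_of_commute]
  exact Subgroup.mem_center_iff.1 (pow_mem (hK.commutatorElement_mem_center x y) d) _

theorem of_mul_of_mem_center {x : K} (hx : x ∈ Subgroup.center K) (y : K) :
    (of (x * y) : BaerGroup hK hd) = of x + of y :=
  of_mul_of_commute (Subgroup.mem_center_iff.1 hx y).symm

theorem symm_add_of_mem_center {x : BaerGroup hK hd} (hx : of.symm x ∈ Subgroup.center K)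
    (y : BaerGroup hK hd) : of.symm (x + y) = of.symm x * of.symm y :=
  (congrArg of.symm (of_mul_of_mem_center hx (of.symm y))).symm

/-- A central subgroup of `K`, viewed as a subgroup of the Baer group. -/
def ofSubgroup (hK : ClassAtMostTwo K) (hd : ∀ x y : K, ⁅x, y⁆ ^ (2 * d + 1) = 1)
    {N : Subgroup K} (hN : N ≤ Subgroup.center K) : AddSubgroup (BaerGroup hK hd) where
  carrier := {x | of.symm x ∈ N}
  zero_mem' := one_mem N
  add_mem' {x y} hx hy := by
    rw [Set.mem_ofPred_eq, symm_add_of_mem_center (hN hx)]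
    exact mul_mem hx hy
  neg_mem' hx := N.inv_mem hx

end BaerGroup

namespace QuadraticHom

variable {K : Type u} [Group K] {d : ℕ} {hK : ClassAtMostTwo K}
  {hd : ∀ x y : K, ⁅x, y⁆ ^ (2 * d + 1) = 1} {V : Type*} [CommGroup V]

/-- The quadratic map on `K` underlying an additive map on the Baer group of `K`. -/
def ofBaer (l : BaerGroup hK hd →+ Additive V) : QuadraticHom K V where
  toFun k := (l (BaerGroup.of k)).toMul
  polar :=
    let ψ : Subgroup.center K →* V := MonoidHom.mk' (fun z => (l (BaerGroup.of (z : K))).toMul)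
      fun z z' => by
        rw [Subgroup.coe_mul, BaerGroup.of_mul_of_mem_center z.2, map_add, toMul_add]
    (MonoidHom.compHom (ψ ^ d)⁻¹).comp
      (commutatorPairing (MonoidHom.id K) (MonoidHom.id K) hK.commutatorElement_mem_center)
  map_mul' x y := by
    simp [BaerGroup.of_mul, div_eq_mul_inv, coe_commutatorPairing]

theorem exists_extend_of_notMem {p : ℕ} [Fact p.Prime] (hodd : Odd p) (hK : ClassAtMostTwo K)
    (hKp : ∀ x : K, x ^ p = 1) (hV : ∀ v : V, v ^ p = 1) {N : Subgroup K}
    (hN : N ≤ Subgroup.center K) (η : N →* V) {k : K} (hk : k ∉ N) (v : V) :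
    ∃ T : QuadraticHom K V, (∀ n : N, T n = η n) ∧ T k = v := by
  obtain ⟨d, rfl⟩ := hodd
  have hd : ∀ x y : K, ⁅x, y⁆ ^ (2 * d + 1) = 1 := fun x y => hKp _
  let _ : Module (ZMod (2 * d + 1)) (BaerGroup hK hd) :=
    AddCommGroup.zmodModule fun x => (BaerGroup.of_pow (BaerGroup.of.symm x) _).symm.trans
      (congrArg BaerGroup.of (hKp _))
  let _ : Module (ZMod (2 * d + 1)) (Additive V) := AddCommGroup.zmodModule hV
  let S := AddSubgroup.toZModSubmodule (2 * d + 1) (BaerGroup.ofSubgroup hK hd hN)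
  let f : S →+ Additive V :=
    AddMonoidHom.mk' (fun x : S => Additive.ofMul (η ⟨BaerGroup.of.symm x.1, x.2⟩)) fun x y =>
      congrArg (fun n => Additive.ofMul (η n))
        (Subtype.ext (BaerGroup.symm_add_of_mem_center (hN x.2) y.1)) |>.trans
        (congrArg Additive.ofMul (map_mul η _ _))
  obtain ⟨l, hlf, hlv⟩ := LinearMap.exists_extend_of_notMem (f.toZModLinearMap _)
    (p := S) (v := BaerGroup.of k) hk (Additive.ofMul v)
  exact ⟨ofBaer l.toAddMonoidHom, fun n => LinearMap.congr_fun hlf ⟨BaerGroup.of n, n.2⟩, hlv⟩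

end QuadraticHom

section Wreath

variable {A K : Type*} [Group A] [Group K]

/-- The action of `K` on functions `K → A` by right translation of the argument. -/
def rightTranslation (A K : Type*) [Group A] [Group K] : K →* MulAut (K → A) where
  toFun k :=
    { toFun := fun F x => F (x * k)
      invFun := fun F x => F (x * k⁻¹)
      left_inv := fun F => by simp
      right_inv := fun F => by simp
      map_mul' := fun _ _ => rfl }
  map_one' := by ext; simp
  map_mul' k k' := by ext; simp [mul_assoc]

theorem rightTranslation_apply (k : K) (F : K → A) (x : K) :
    rightTranslation A K k F x = F (x * k) := rfl

/-- The unrestricted wreath product of `A` by the regular action of `K`. With right translation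
instead of the left translation of `RegularWreathProduct`, a map `T : K → A` is moved by `k` to
`x ↦ T (x * k)`. -/
abbrev TranslationWreath (A K : Type*) [Group A] [Group K] : Type _ :=
  (K → A) ⋊[rightTranslation A K] K

namespace TranslationWreath

open SemidirectProduct

theorem commute_inl_mul_inr_inl {F F' : K → A} {k : K} :
    Commute (inl F * inr k : TranslationWreath A K) (inl F') ↔
      ∀ x, F x * F' (x * k) = F' x * F x := by
  rw [Commute, SemiconjBy, SemidirectProduct.ext_iff]
  simp [funext_iff, rightTranslation_apply]

theorem commute_inl_mul_inr_inr {F : K → A} {k k' : K} :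
    Commute (inl F * inr k : TranslationWreath A K) (inr k') ↔
      (∀ x, F (x * k') = F x) ∧ Commute k k' := by
  rw [Commute, SemiconjBy, SemidirectProduct.ext_iff]
  simp [funext_iff, rightTranslation_apply, Commute, SemiconjBy, eq_comm]

theorem commutatorElement_inr_inl (k : K) (F : K → A) :
    ⁅(inr k : TranslationWreath A K), (inl F : TranslationWreath A K)⁆ =
      inl fun x => F (x * k) * (F x)⁻¹ := by
  rw [commutatorElement_def, ← map_inv, ← inl_aut, ← map_inv, ← map_mul]
  rfl

theorem inl_const_mem_center {c : A} (hc : c ∈ Subgroup.center A) :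
    inl (φ := rightTranslation A K) (fun _ => c) ∈ Subgroup.center (TranslationWreath A K) := by
  rw [Subgroup.mem_center_iff]
  intro w
  refine SemidirectProduct.ext (funext fun x => ?_) (by simp)
  simpa using! Subgroup.mem_center_iff.1 hc (w.left x)

end TranslationWreath

end Wreath

/-- The data of a representation of a free product `L * K` in the wreath product of `A` by `K`:
a cover `π : L → G`, a homomorphism `α : L → A` mapping the kernel of `π` into the centre, and a
quadratic map `T` on `K` whose values are characters of `G` with values in `C`, which `ι` maps into
the centre of `A`. -/
structure WreathTwist (L G K A C : Type*) [Group L] [Group G] [Group K] [Group A]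
    [CommGroup C] where
  π : L →* G
  π_surjective : Function.Surjective π
  α : L →* A
  α_mem_center : ∀ l, π l = 1 → α l ∈ Subgroup.center A
  T : QuadraticHom K (G →* C)
  ι : C →* A
  ι_mem_center : ∀ c, ι c ∈ Subgroup.center A

namespace WreathTwist

open Monoid (Coprod)
open SemidirectProduct (inl inr)

section Representation

variable {L G K A C : Type*} [Group L] [Group G] [Group K] [Group A] [CommGroup C]
  (D : WreathTwist L G K A C)

/-- The representation of `L` on the base group of the wreath product, twisted at `x : K` by the
character `T x`. -/
def base : L →* K → A :=
  MonoidHom.mk' (fun l x => D.α l * D.ι (D.T x (D.π l))) fun l l' => funext fun x => by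
    have := Subgroup.mem_center_iff.1 (D.ι_mem_center (D.T x (D.π l))) (D.α l')
    simp only [map_mul, Pi.mul_apply, mul_assoc]
    rw [← mul_assoc (D.α l'), this, mul_assoc]

theorem base_apply (l : L) (x : K) : D.base l x = D.α l * D.ι (D.T x (D.π l)) := rfl

/-- The representation of the free product given by `base` on `L` and by the complement `K` of the
wreath product. -/
def rep : Coprod L K →* TranslationWreath A K := Coprod.lift (inl.comp D.base) inr

@[simp]
theorem rep_inl (l : L) : D.rep (Coprod.inl l) = inl (D.base l) := Coprod.lift_apply_inl _ _ _

@[simp]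
theorem rep_inr (k : K) : D.rep (Coprod.inr k) = inr k := Coprod.lift_apply_inr _ _ _

theorem mem_centralKernel_rep {w : Coprod L K} (hl : ∀ l, Commute (D.rep w) (inl (D.base l)))
    (hr : ∀ k, Commute (D.rep w) (inr k)) : w ∈ centralKernel D.rep := by
  have range_le : D.rep.range ≤ Subgroup.centralizer {D.rep w} := by
    rw [rep, Coprod.range_lift, sup_le_iff]
    constructor
    · rintro _ ⟨l, rfl⟩
      exact Subgroup.mem_centralizer_singleton_iff.2 (hl l).symm
    · rintro _ ⟨k, rfl⟩
      exact Subgroup.mem_centralizer_singleton_iff.2 (hr k).symm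
  exact mem_centralKernel.2 fun x =>
    (Subgroup.mem_centralizer_singleton_iff.1 (range_le ⟨x, rfl⟩)).symm

theorem base_apply_mul (l : L) (x k : K) : D.base l (x * k) =
    D.base l x * D.ι (D.T k (D.π l) * D.T.polar x k (D.π l)) := by
  simp [base_apply, D.T.map_mul, mul_assoc]

theorem rep_commutatorElement (k : K) (l : L) :
    D.rep ⁅(Coprod.inr k : Coprod L K), (Coprod.inl l : Coprod L K)⁆ =
      inl fun x => D.ι (D.T k (D.π l) * D.T.polar x k (D.π l)) := by
  rw [map_commutatorElement, rep_inl, rep_inr, TranslationWreath.commutatorElement_inr_inl]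
  congr 1
  ext x
  rw [base_apply_mul, Subgroup.mem_center_iff.1 (D.ι_mem_center _), mul_inv_cancel_right]

theorem inl_mem_centralKernel {l : L} (hl : D.π l = 1) : Coprod.inl l ∈ centralKernel D.rep := by
  have base_eq : D.base l = fun _ => D.α l := by
    ext x
    simp [base_apply, hl]
  refine mem_centralKernel_of_mem_center ?_
  rw [rep_inl, base_eq]
  exact TranslationWreath.inl_const_mem_center (D.α_mem_center l hl)

/-- The homomorphism from `G` to the central quotient of the representation. -/
noncomputable def left : G →* Coprod L K ⧸ centralKernel D.rep :=
  D.π.liftOfSurjective D.π_surjective ⟨(QuotientGroup.mk' _).comp Coprod.inl, fun _ hl =>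
    (QuotientGroup.eq_one_iff _).2 (D.inl_mem_centralKernel hl)⟩

theorem left_π (l : L) : D.left (D.π l) = (Coprod.inl l : Coprod L K) :=
  MonoidHom.liftOfRightInverse_comp_apply _ _ _ _ l

/-- The homomorphism from `K` to the central quotient of the representation. -/
def right : K →* Coprod L K ⧸ centralKernel D.rep := (QuotientGroup.mk' _).comp Coprod.inr

theorem right_apply (k : K) : D.right k = (Coprod.inr k : Coprod L K) := rfl

theorem closure_range_left_union_range_right :
    Subgroup.closure (Set.range D.left ∪ Set.range D.right) = ⊤ := by
  have range_left : Set.range D.left =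
      QuotientGroup.mk' (centralKernel D.rep) '' Set.range Coprod.inl := by
    rw [← Set.range_comp, ← D.π_surjective.range_comp]
    exact congrArg Set.range (funext D.left_π)
  have range_right : Set.range D.right =
      QuotientGroup.mk' (centralKernel D.rep) '' Set.range Coprod.inr := by
    rw [← Set.range_comp]
    rfl
  rw [range_left, range_right, ← Set.image_union, ← MonoidHom.map_closure,
    Coprod.closure_range_inl_union_inr,
    Subgroup.map_top_of_surjective _ (QuotientGroup.mk'_surjective _)]

theorem commutatorElement_right_left_mem_center (k : K) (g : G) :
    ⁅D.right k, D.left g⁆ ∈ Subgroup.center (Coprod L K ⧸ centralKernel D.rep) := by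
  obtain ⟨l, rfl⟩ := D.π_surjective g
  refine mem_center_of_closure_eq_top D.closure_range_left_union_range_right ?_
  rw [left_π, right_apply]
  rintro _ (⟨g', rfl⟩ | ⟨k', rfl⟩)
  · obtain ⟨l', rfl⟩ := D.π_surjective g'
    rw [left_π]
    have commute_rep : Commute (D.rep (Coprod.inl l'))
        (D.rep ⁅(Coprod.inr k : Coprod L K), (Coprod.inl l : Coprod L K)⁆) := by
      rw [rep_commutatorElement, rep_inl]
      exact Commute.map (funext fun x => Subgroup.mem_center_iff.1 (D.ι_mem_center _) _) inl
    refine commute_mk_commutatorElement_iff.2 (mem_centralKernel_of_mem_center ?_)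
    rw [map_commutatorElement, commutatorElement_eq_one_iff_commute.2 commute_rep]
    exact one_mem _
  · refine commute_mk_commutatorElement_iff.2 (mem_centralKernel_of_mem_center ?_)
    have const : (fun x => D.ι (D.T k (D.π l) * D.T.polar (x * k') k (D.π l)) *
        (D.ι (D.T k (D.π l) * D.T.polar x k (D.π l)))⁻¹) =
        fun _ => D.ι (D.T.polar k' k (D.π l)) := by
      funext x
      rw [← map_inv, ← map_mul, map_mul D.T.polar, MonoidHom.mul_apply, MonoidHom.mul_apply,
        ← mul_assoc, mul_right_comm, mul_inv_cancel, one_mul]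
    rw [map_commutatorElement, rep_commutatorElement, rep_inr,
      TranslationWreath.commutatorElement_inr_inl, const]
    exact TranslationWreath.inl_const_mem_center (D.ι_mem_center _)

theorem left_eq_right {g : G} {k : K} (hg : g ∈ commutator G) (hk : k ∈ commutator K)
    (hk' : k ∈ Subgroup.center K)
    (h : ∀ l l', D.π l = g → D.ι (D.T k (D.π l')) = ⁅D.α l, D.α l'⁆) : D.left g = D.right k := by
  obtain ⟨l, rfl⟩ := D.π_surjective g
  have base_eq : D.base l = fun _ => D.α l := by
    ext x
    simp [base_apply, MonoidHom.mem_ker.1 (Abelianization.commutator_subset_ker (D.T x) hg)]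
  have polar_eq (x : K) : D.T.polar x k = 1 :=
    Abelianization.commutator_subset_ker (D.T.polar x) hk
  rw [left_π, right_apply, QuotientGroup.eq_iff_div_mem, div_eq_mul_inv, ← map_inv]
  refine D.mem_centralKernel_rep (fun l' => ?_) fun k' => ?_
  all_goals rw [map_mul, rep_inl, rep_inr, base_eq]
  · refine TranslationWreath.commute_inl_mul_inr_inl.2 fun x => ?_
    have base_mul : D.base l' x = D.base l' (x * k⁻¹) * ⁅D.α l, D.α l'⁆ := by
      rw [← h l l' rfl, ← mul_one (D.T k (D.π l')), ← MonoidHom.one_apply (D.π l'),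
        ← polar_eq (x * k⁻¹), ← base_apply_mul, inv_mul_cancel_right]
    have comm_ι := Subgroup.mem_center_iff.1 (D.ι_mem_center (D.T (x * k⁻¹) (D.π l')))
    have comm_commutator := Subgroup.mem_center_iff.1
      (h l l' rfl ▸ D.ι_mem_center (D.T k (D.π l'))) (D.α l')
    calc D.α l * D.base l' (x * k⁻¹)
        = D.ι (D.T (x * k⁻¹) (D.π l')) * (D.α l * D.α l') := by
          rw [base_apply, ← mul_assoc, comm_ι]
      _ = D.ι (D.T (x * k⁻¹) (D.π l')) * (⁅D.α l, D.α l'⁆ * (D.α l' * D.α l)) := by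
          rw [← mul_eq_commutatorElement_mul]
      _ = D.base l' x * D.α l := by
          rw [base_mul, base_apply, comm_ι, mul_assoc _ (D.α l'), comm_commutator]
          simp only [mul_assoc]
  · exact TranslationWreath.commute_inl_mul_inr_inr.2
      ⟨fun _ => rfl, (Subgroup.mem_center_iff.1 (inv_mem hk') k').symm⟩

end Representation

section ClassTwo

variable {L A C : Type*} {G : Type u} {K : Type v} [Group L] [Group G] [Group K] [Group A]
  [CommGroup C] (D : WreathTwist L G K A C)

theorem classAtMostTwo (hG : ClassAtMostTwo G) (hK : ClassAtMostTwo K) :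
    ClassAtMostTwo (Coprod L K ⧸ centralKernel D.rep) :=
  hG.of_closure_range_union_range hK D.closure_range_left_union_range_right fun g k => by
    rw [← commutatorElement_inv]
    exact inv_mem (D.commutatorElement_right_left_mem_center k g)

end ClassTwo

end WreathTwist

section Abelianization

variable {G K : Type*} [Group G] [Group K]

/-- The class of a group element in the abelianization, written additively so that linear algebra
applies when the group has prime exponent. -/
def abClass (g : G) : Additive (Abelianization G) := Additive.ofMul (Abelianization.of g)

theorem abClass_surjective : Function.Surjective (abClass : G → _) := fun x =>
  (QuotientGroup.mk_surjective x.toMul).imp fun _ => congrArg Additive.ofMul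

theorem abClass_eq_zero_iff {g : G} : abClass g = 0 ↔ g ∈ commutator G := by
  rw [← Abelianization.ker_of, MonoidHom.mem_ker]
  rfl

/-- The character of a group defined by an additive functional on its abelianization. -/
def abCharacter {R : Type*} [AddGroup R] (f : Additive (Abelianization G) →+ R) :
    G →* Multiplicative R :=
  f.toMultiplicativeRight.comp Abelianization.of

theorem abelianization_nsmul_eq_zero {n : ℕ} (h : ∀ g : G, g ^ n = 1)
    (x : Additive (Abelianization G)) : n • x = 0 := by
  obtain ⟨g, rfl⟩ := abClass_surjective x
  rw [abClass, ← ofMul_pow, ← map_pow, h, map_one, ofMul_one]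

theorem exists_abelianizationTensor_lift {n : ℕ} [NeZero n]
    [Module (ZMod n) (Additive (Abelianization G))]
    [Module (ZMod n) (Additive (Abelianization K))] {X : Type*} [CommGroup X] (β : G →* K →* X) :
    ∃ τ : Additive (Abelianization G) ⊗[ZMod n] Additive (Abelianization K) →+ Additive X,
      ∀ g k, (τ (abClass g ⊗ₜ abClass k)).toMul = β g k := by
  let β₁ : Abelianization G →* Abelianization K →* X :=
    Abelianization.lift <| MonoidHom.mk' (fun g => Abelianization.lift (β g)) fun g g' => by
      ext k
      simp
  let β₂ : Additive (Abelianization G) →+ Additive (Abelianization K) →+ Additive X :=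
    AddMonoidHom.mk' (fun x => (β₁ x.toMul).toAdditive) fun x y => by
      ext z
      simp
  refine ⟨TensorProduct.liftAddHom β₂ fun r x y => ?_, fun _ _ => rfl⟩
  obtain ⟨m, rfl⟩ := ZMod.natCast_zmod_surjective r
  rw [Nat.cast_smul_eq_nsmul, Nat.cast_smul_eq_nsmul, map_nsmul, map_nsmul]
  rfl

end Abelianization

section TensorDual

open Module

variable {k U V : Type*} [Field k] [AddCommGroup U] [Module k U] [AddCommGroup V] [Module k V]

theorem tensorProduct_eq_zero_of_forall_dualDistrib {s : U ⊗[k] V}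
    (h : ∀ (f : Dual k U) (f' : Dual k V), TensorProduct.dualDistrib k U V (f ⊗ₜ f') s = 0) :
    s = 0 := by
  let B := Basis.ofVectorSpace k U
  let B' := Basis.ofVectorSpace k V
  refine (B.tensorProduct B').ext_elem fun ij => ?_
  have coord_eq : (B.tensorProduct B').coord ij =
      TensorProduct.dualDistrib k U V (B.coord ij.1 ⊗ₜ B'.coord ij.2) :=
    TensorProduct.ext' fun x y => by
      simp [Module.Basis.tensorProduct_repr_tmul_apply B B' x y ij.1 ij.2, mul_comm]
  rw [← Basis.coord_apply, coord_eq, h, map_zero, Finsupp.zero_apply]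

end TensorDual

/-- `P` is the amalgamated coproduct of `G` and `K` along `a` and `b` in the variety of groups of
class at most two. -/
structure IsAmalgam {G : Type u} {K : Type v} {P : Type (max u v)} {H : Type*} [Group G] [Group K]
    [Group P] [Group H] (a : H →* G) (b : H →* K) (inl : G →* P) (inr : K →* P) : Prop where
  classAtMostTwo : ClassAtMostTwo P
  closure_eq_top : Subgroup.closure (Set.range inl ∪ Set.range inr) = ⊤
  comm : ∀ h, inl (a h) = inr (b h)
  exists_lift : ∀ (Q : Type (max u v)) [Group Q], ClassAtMostTwo Q →
    ∀ (f : G →* Q) (g : K →* Q), (∀ h, f (a h) = g (b h)) →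
      ∃ F : P →* Q, (∀ x, F (inl x) = f x) ∧ ∀ y, F (inr y) = g y

theorem TwoNilpotentProduct.exists_lift {G : Type u} {K : Type v} [Group G] [Group K] {Q : Type w}
    [Group Q] (hQ : ClassAtMostTwo Q) (f : G →* Q) (g : K →* Q) :
    ∃ F : TwoNilpotentProduct G K →* Q, (∀ x, F (inl G K x) = f x) ∧ ∀ y, F (inr G K y) = g y := by
  refine ⟨QuotientGroup.lift _ (Monoid.Coprod.lift f g) fun x hx => ?_, fun x => ?_, fun y => ?_⟩
  · have hx' := Subgroup.mem_map_of_mem (Monoid.Coprod.lift f g) hx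
    rw [Subgroup.map_lowerCentralSeries] at hx'
    exact Subgroup.mem_bot.1 (hQ.le (Subgroup.lowerCentralSeries_mono 2 le_top hx'))
  · exact Monoid.Coprod.lift_apply_inl f g x
  · exact Monoid.Coprod.lift_apply_inr f g y

theorem AmalgamatedCoproduct.isAmalgam {G : Type u} {K : Type v} [Group G] [Group K]
    (H : Subgroup G) (φ : H →* commutator K) :
    IsAmalgam (P := AmalgamatedCoproduct H φ) H.subtype ((commutator K).subtype.comp φ)
      ((QuotientGroup.mk' _).comp (TwoNilpotentProduct.inl G K))
      ((QuotientGroup.mk' _).comp (TwoNilpotentProduct.inr G K)) where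
  classAtMostTwo := by
    have hs := QuotientGroup.mk'_surjective (Subgroup.normalClosure (amalgamSet H φ))
    rw [ClassAtMostTwo, ← Subgroup.map_top_of_surjective _ hs, ← Subgroup.map_lowerCentralSeries,
      ClassAtMostTwo.iff_commutator_le_center.2 (TwoNilpotentProduct.commutator_le_center G K),
      Subgroup.map_bot]
  closure_eq_top := by
    let q : Monoid.Coprod G K →* AmalgamatedCoproduct H φ :=
      (QuotientGroup.mk' (Subgroup.normalClosure (amalgamSet H φ))).comp (QuotientGroup.mk' _)
    have hq : Function.Surjective q :=
      (QuotientGroup.mk'_surjective _).comp (QuotientGroup.mk'_surjective _)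
    have map_closure := q.map_closure (Set.range Monoid.Coprod.inl ∪ Set.range Monoid.Coprod.inr)
    rw [Monoid.Coprod.closure_range_inl_union_inr, Subgroup.map_top_of_surjective q hq,
      Set.image_union, ← Set.range_comp, ← Set.range_comp] at map_closure
    exact map_closure.symm
  comm h := QuotientGroup.eq_iff_div_mem.2 (Subgroup.subset_normalClosure ⟨h, div_eq_mul_inv _ _⟩)
  exists_lift Q _ hQ f g hfg := by
    obtain ⟨F, hl, hr⟩ := TwoNilpotentProduct.exists_lift hQ f g
    refine ⟨QuotientGroup.lift _ F fun x hx => ?_, hl, hr⟩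
    refine Subgroup.normalClosure_le_normal (N := F.ker) ?_ hx
    rintro _ ⟨h, rfl⟩
    exact MonoidHom.mem_ker.2 (by rw [map_mul, map_inv, hl, hr, mul_inv_eq_one]; exact hfg h)

namespace IsAmalgam

theorem symm {G : Type u} {K : Type v} {P : Type (max u v)} {H : Type*} [Group G] [Group K]
    [Group P] [Group H] {a : H →* G} {b : H →* K} {inl : G →* P} {inr : K →* P}
    (hP : IsAmalgam a b inl inr) : IsAmalgam b a inr inl where
  classAtMostTwo := hP.classAtMostTwo
  closure_eq_top := by rw [Set.union_comm, hP.closure_eq_top]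
  comm h := (hP.comm h).symm
  exists_lift Q _ hQ f g hfg :=
    (hP.exists_lift Q hQ g f fun h => (hfg h).symm).imp fun _ => And.symm

variable {G : Type u} {K : Type v} {P : Type (max u v)} {H : Type*} [Group G] [Group K] [Group P]
  [Group H] {a : H →* G} {b : H →* K} {inl : G →* P} {inr : K →* P}

open Monoid (Coprod)

theorem exists_hom_wreathTwist (hP : IsAmalgam a b inl inr) (hG : ClassAtMostTwo G)
    (hK : ClassAtMostTwo K) {L : Type u} {A C : Type*} [Group L] [Group A] [CommGroup C]
    (D : WreathTwist L G K A C) (ha : ∀ h, a h ∈ commutator G) (hb : ∀ h, b h ∈ commutator K)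
    (hT : ∀ h l l', D.π l = a h → D.ι (D.T (b h) (D.π l')) = ⁅D.α l, D.α l'⁆) :
    ∃ Ψ : P →* Coprod L K ⧸ centralKernel D.rep,
      (∀ l, Ψ (inl (D.π l)) = (Coprod.inl l : Coprod L K)) ∧
        ∀ k, Ψ (inr k) = (Coprod.inr k : Coprod L K) := by
  obtain ⟨Ψ, hΨl, hΨr⟩ := hP.exists_lift _ (D.classAtMostTwo hG hK) D.left D.right fun h =>
    D.left_eq_right (ha h) (hb h) (hK.commutator_le_center (hb h)) (hT h)
  exact ⟨Ψ, fun l => (hΨl _).trans (D.left_π l), hΨr⟩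

theorem exists_eq_mul (hP : IsAmalgam a b inl inr) {S : Type*} [AddCommGroup S]
    {σ : G → K → S} {τ : S →+ Additive (Subgroup.center P)}
    (hτ : ∀ g k, ((τ (σ g k)).toMul : P) = ⁅inr k, inl g⁆) (z : P) :
    ∃ s g k, z = (τ s).toMul * (inl g * inr k) := by
  have inl_mul (x : G) {y : P} : (∃ s g k, y = (τ s).toMul * (inl g * inr k)) →
      ∃ s g k, inl x * y = (τ s).toMul * (inl g * inr k) := by
    rintro ⟨s, g, k, rfl⟩
    refine ⟨s, x * g, k, ?_⟩
    rw [← mul_assoc, Subgroup.mem_center_iff.1 (τ s).toMul.2, map_mul]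
    simp only [mul_assoc]
  have inr_mul (x : K) {y : P} : (∃ s g k, y = (τ s).toMul * (inl g * inr k)) →
      ∃ s g k, inr x * y = (τ s).toMul * (inl g * inr k) := by
    rintro ⟨s, g, k, rfl⟩
    refine ⟨s + σ g x, g, x * k, ?_⟩
    rw [← mul_assoc, Subgroup.mem_center_iff.1 (τ s).toMul.2, mul_assoc, ← mul_assoc (inr x),
      mul_eq_commutatorElement_mul (inr x), ← hτ, map_add, map_mul, toMul_add, Subgroup.coe_mul]
    simp only [mul_assoc]
  have hz : z ∈ Subgroup.closure (Set.range inl ∪ Set.range inr) :=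
    hP.closure_eq_top ▸ Subgroup.mem_top z
  refine Subgroup.closure_induction_left
    (p := fun y _ => ∃ s g k, y = (τ s).toMul * (inl g * inr k)) ⟨0, 1, 1, by simp⟩ ?_ ?_ hz
  · rintro _ (⟨x, rfl⟩ | ⟨x, rfl⟩) y _ hy
    exacts [inl_mul x hy, inr_mul x hy]
  · rintro _ (⟨x, rfl⟩ | ⟨x, rfl⟩) y _ hy
    · exact map_inv inl x ▸ inl_mul x⁻¹ hy
    · exact map_inv inr x ▸ inr_mul x⁻¹ hy

end IsAmalgam

namespace WreathTwist

open SemidirectProduct (inl inr)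
open Monoid (Coprod)

section Characters

variable {G K R : Type*} [Group G] [Group K] [CommRing R] (f : G →* Multiplicative R)
  (f' : K →* Multiplicative R)

/-- The scalar representation of `G * K` twisted by `QuadraticHom.ofCharacters f f'`. -/
def ofCharacters : WreathTwist G G K (Multiplicative R) (Multiplicative R) where
  π := MonoidHom.id G
  π_surjective := Function.surjective_id
  α := 1
  α_mem_center _ _ := one_mem _
  T := QuadraticHom.ofCharacters f f'
  ι := MonoidHom.id _
  ι_mem_center c := Subgroup.mem_center_iff.2 fun c' => mul_comm c' c

variable {f f'}

theorem toAdd_base_ofCharacters (g : G) (x : K) :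
    ((ofCharacters f f').base g x).toAdd = (f g).toAdd * (f' x).toAdd ^ 2 := by
  rw [base_apply, toAdd_mul]
  exact zero_add _

theorem rep_ofCharacters_commutatorElement (g : G) (k : K) :
    (ofCharacters f f').rep ⁅(Coprod.inr k : Coprod G K), (Coprod.inl g : Coprod G K)⁆ =
      inl fun x => Multiplicative.ofAdd ((f g).toAdd * (f' k).toAdd ^ 2 +
        2 * ((f g).toAdd * (f' k).toAdd) * (f' x).toAdd) := by
  rw [rep_commutatorElement]
  congr 1
  ext x
  change (f g).toAdd * (f' k).toAdd ^ 2 + (f g).toAdd * (2 * (f' x).toAdd * (f' k).toAdd) = _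
  rw [toAdd_ofAdd]
  ring

theorem mul_eq_zero_of_commute_rep_ofCharacters [IsDomain R] (h2 : (2 : R) ≠ 0) {w : Coprod G K}
    {g : G} {k : K} {c φ : R}
    (hw : (ofCharacters f f').rep w =
      inl fun x => Multiplicative.ofAdd (c + 2 * φ * (f' x).toAdd))
    {g' : G} {k' : K}
    (hg' : Commute ((ofCharacters f f').rep (w * (Coprod.inl g * Coprod.inr k)))
      ((ofCharacters f f').rep (Coprod.inl g')))
    (hk' : Commute ((ofCharacters f f').rep (w * (Coprod.inl g * Coprod.inr k)))
      ((ofCharacters f f').rep (Coprod.inr k'))) :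
    (f g').toAdd * (f' k).toAdd = 0 ∧ (f g).toAdd * (f' k').toAdd = 0 ∧
      φ * (f' k').toAdd = 0 := by
  set E : K → Multiplicative R := fun x =>
    Multiplicative.ofAdd (c + 2 * φ * (f' x).toAdd) * (ofCharacters f f').base g x with hE
  have rep_eq : (ofCharacters f f').rep (w * (Coprod.inl g * Coprod.inr k)) =
      inl E * inr k := by
    rw [map_mul, map_mul, hw, rep_inl, rep_inr, ← mul_assoc, ← map_mul]
    rfl
  have toAdd_E (x : K) : (E x).toAdd =
      c + 2 * φ * (f' x).toAdd + (f g).toAdd * (f' x).toAdd ^ 2 := by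
    rw [hE, toAdd_mul, toAdd_base_ofCharacters, toAdd_ofAdd]
  rw [rep_eq, rep_inl, TranslationWreath.commute_inl_mul_inr_inl] at hg'
  rw [rep_eq, rep_inr, TranslationWreath.commute_inl_mul_inr_inr] at hk'
  have base_k : (f g').toAdd * (f' k).toAdd ^ 2 = 0 := by
    have base_eq := mul_right_cancel ((mul_comm _ _).trans (hg' 1))
    simpa [toAdd_base_ofCharacters] using congrArg Multiplicative.toAdd base_eq
  have E_mul (x : K) : (E (x * k')).toAdd = (E x).toAdd := congrArg _ (hk'.1 x)
  have E_one := E_mul 1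
  have E_k' := E_mul k'
  simp only [toAdd_E, map_mul, map_one, toAdd_mul, toAdd_one] at E_one E_k'
  have gk' : (f g).toAdd * (f' k').toAdd ^ 2 = 0 := by
    refine (mul_eq_zero.1 (?_ : 2 * ((f g).toAdd * (f' k').toAdd ^ 2) = 0)).resolve_left h2
    linear_combination E_k' - E_one
  have φk' : φ * (f' k').toAdd = 0 := by
    refine (mul_eq_zero.1 (?_ : 2 * (φ * (f' k').toAdd) = 0)).resolve_left h2
    linear_combination E_one - gk'
  exact ⟨by simpa using base_k, by simpa using gk', φk'⟩

end Characters

section PrimeExponent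

open Module (Dual)

variable {G K P : Type*} [Group G] [Group K] [Group P] {p : ℕ}
  [Module (ZMod p) (Additive (Abelianization G))] [Module (ZMod p) (Additive (Abelianization K))]

/-- The twist by the characters attached to functionals on the abelianizations. -/
abbrev ofDuals (f : Dual (ZMod p) (Additive (Abelianization G)))
    (f' : Dual (ZMod p) (Additive (Abelianization K))) :
    WreathTwist G G K (Multiplicative (ZMod p)) (Multiplicative (ZMod p)) :=
  ofCharacters (abCharacter f.toAddMonoidHom) (abCharacter f'.toAddMonoidHom)

variable {f : Dual (ZMod p) (Additive (Abelianization G))}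
  {f' : Dual (ZMod p) (Additive (Abelianization K))}

theorem exists_rep_ofDuals_eq {i : G →* P} {j : K →* P}
    {Ψ : P →* Coprod G K ⧸ centralKernel (ofDuals f f').rep}
    (hi : ∀ g, Ψ (i g) = (Coprod.inl g : Coprod G K))
    (hj : ∀ k, Ψ (j k) = (Coprod.inr k : Coprod G K))
    {τ : Additive (Abelianization G) ⊗[ZMod p] Additive (Abelianization K) →+
      Additive (Subgroup.center P)}
    (hτ : ∀ g k, ((τ (abClass g ⊗ₜ abClass k)).toMul : P) = ⁅j k, i g⁆)
    (s : Additive (Abelianization G) ⊗[ZMod p] Additive (Abelianization K)) :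
    ∃ w c, Ψ (τ s).toMul = (w : Coprod G K) ∧
      (ofDuals f f').rep w = inl fun x => Multiplicative.ofAdd
        (c + 2 * TensorProduct.dualDistrib (ZMod p) _ _ (f ⊗ₜ f') s * f' (abClass x)) := by
  induction s using TensorProduct.induction_on with
  | zero =>
    refine ⟨1, 0, by simp, ?_⟩
    simp only [map_one, map_zero, mul_zero, zero_mul, add_zero, ofAdd_zero]
    exact (map_one inl).symm
  | tmul u v =>
    obtain ⟨g, rfl⟩ := abClass_surjective u
    obtain ⟨k, rfl⟩ := abClass_surjective v
    refine ⟨⁅Coprod.inr k, Coprod.inl g⁆, f (abClass g) * f' (abClass k) ^ 2, ?_,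
      rep_ofCharacters_commutatorElement g k⟩
    rw [hτ, map_commutatorElement, hi, hj]
    rfl
  | add s t hs ht =>
    obtain ⟨w, c, hw, hrep⟩ := hs
    obtain ⟨w', c', hw', hrep'⟩ := ht
    refine ⟨w * w', c + c', ?_, ?_⟩
    · rw [map_add, toMul_add, Subgroup.coe_mul, map_mul, hw, hw']
      rfl
    · rw [map_mul, hrep, hrep', ← map_mul]
      congr 1
      ext x
      change (_ + _ : ZMod p) = _ + _
      rw [map_add, mul_add, add_mul, add_add_add_comm]
      rfl

end PrimeExponent

end WreathTwist

namespace IsAmalgam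

variable {G : Type u} {K : Type v} {P : Type (max u v)} {H : Type*} [Group G] [Group K] [Group P]
  [Group H] {a : H →* G} {b : H →* K} {inl : G →* P} {inr : K →* P} {p : ℕ} [Fact p.Prime]

section Module

open Monoid (Coprod)
open Module (Dual)

variable [Module (ZMod p) (Additive (Abelianization G))]
  [Module (ZMod p) (Additive (Abelianization K))]
  {τ : Additive (Abelianization G) ⊗[ZMod p] Additive (Abelianization K) →+
    Additive (Subgroup.center P)}

theorem dual_mul_eq_zero_of_mem_epicenter (hP : IsAmalgam a b inl inr) (h2 : p ≠ 2)
    (hG : ClassAtMostTwo G) (hK : ClassAtMostTwo K) (ha : ∀ h, a h ∈ commutator G)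
    (hb : ∀ h, b h ∈ commutator K)
    (hτ : ∀ g k, ((τ (abClass g ⊗ₜ abClass k)).toMul : P) = ⁅inr k, inl g⁆)
    {s : Additive (Abelianization G) ⊗[ZMod p] Additive (Abelianization K)} {g : G} {k : K}
    (hz : (τ s).toMul * (inl g * inr k) ∈ epicenter P)
    (f : Dual (ZMod p) (Additive (Abelianization G)))
    (f' : Dual (ZMod p) (Additive (Abelianization K))) (g' : G) (k' : K) :
    f (abClass g') * f' (abClass k) = 0 ∧ f (abClass g) * f' (abClass k') = 0 ∧
      TensorProduct.dualDistrib (ZMod p) _ _ (f ⊗ₜ f') s * f' (abClass k') = 0 := by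
  let D := WreathTwist.ofDuals f f'
  have hT (h : H) (l l' : G) (_ : l = a h) :
      D.ι (D.T (b h) (D.π l')) = ⁅D.α l, D.α l'⁆ := by
    rw [commutatorElement_eq_one_iff_mul_comm.2 (mul_comm (D.α l) (D.α l'))]
    change f (abClass l') * f' (abClass (b h)) ^ 2 = 0
    rw [abClass_eq_zero_iff.2 (hb h), map_zero, sq, mul_zero, mul_zero]
  obtain ⟨Ψ, hΨl, hΨr⟩ := hP.exists_hom_wreathTwist hG hK D ha hb hT
  obtain ⟨w, c, hw, hrep⟩ := WreathTwist.exists_rep_ofDuals_eq hΨl hΨr hτ s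
  have two_ne_zero : (2 : ZMod p) ≠ 0 := Ring.two_ne_zero (by rwa [ZMod.ringChar_zmod_n])
  have Ψ_eq : Ψ ((τ s).toMul * (inl g * inr k)) =
      (w * (Coprod.inl g * Coprod.inr k) : Coprod G K) := by
    rw [map_mul, map_mul, hw, hΨr]
    exact congrArg (fun x => _ * (x * _)) (hΨl g)
  exact WreathTwist.mul_eq_zero_of_commute_rep_ofCharacters two_ne_zero hrep
    (commute_of_mem_epicenter Ψ hz Ψ_eq (hΨl g')) (commute_of_mem_epicenter Ψ hz Ψ_eq (hΨr k'))

theorem exists_mem_commutator_of_mem_epicenter (hP : IsAmalgam a b inl inr) (h2 : p ≠ 2)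
    (hG : ClassAtMostTwo G) (hK : ClassAtMostTwo K) (ha : ∀ h, a h ∈ commutator G)
    (hb : ∀ h, b h ∈ commutator K) (hG' : commutator G ≠ ⊤) (hK' : commutator K ≠ ⊤) {z : P}
    (hz : z ∈ epicenter P) : ∃ g ∈ commutator G, ∃ k ∈ commutator K, z = inl g * inr k := by
  obtain ⟨τ, hτ⟩ := exists_abelianizationTensor_lift (n := p)
    (commutatorPairing inr inl fun _ _ => hP.classAtMostTwo.commutatorElement_mem_center _ _).flip
  replace hτ (g : G) (k : K) : ((τ (abClass g ⊗ₜ abClass k)).toMul : P) = ⁅inr k, inl g⁆ :=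
    congrArg Subtype.val (hτ g k)
  obtain ⟨s, g, k, rfl⟩ := hP.exists_eq_mul hτ z
  have key := hP.dual_mul_eq_zero_of_mem_epicenter h2 hG hK ha hb hτ hz
  obtain ⟨g₀, hg₀⟩ := SetLike.exists_not_mem_of_ne_top _ hG' rfl
  obtain ⟨k₀, hk₀⟩ := SetLike.exists_not_mem_of_ne_top _ hK' rfl
  obtain ⟨f₀, hf₀⟩ := Module.Projective.exists_dual_ne_zero (ZMod p)
    (mt abClass_eq_zero_iff.1 hg₀)
  obtain ⟨f₁, hf₁⟩ := Module.Projective.exists_dual_ne_zero (ZMod p)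
    (mt abClass_eq_zero_iff.1 hk₀)
  have hk : k ∈ commutator K := abClass_eq_zero_iff.1 <|
    (Module.forall_dual_apply_eq_zero_iff (ZMod p) _).1 fun f' =>
      (mul_eq_zero.1 (key f₀ f' g₀ 1).1).resolve_left hf₀
  have hg : g ∈ commutator G := abClass_eq_zero_iff.1 <|
    (Module.forall_dual_apply_eq_zero_iff (ZMod p) _).1 fun f =>
      (mul_eq_zero.1 (key f f₁ 1 k₀).2.1).resolve_right hf₁
  have hs : s = 0 := tensorProduct_eq_zero_of_forall_dualDistrib fun f f' => by
    by_cases hf' : f' = 0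
    · simp [hf']
    · obtain ⟨x, hx⟩ := DFunLike.ne_iff.1 hf'
      obtain ⟨k', rfl⟩ := abClass_surjective x
      exact (mul_eq_zero.1 (key f f' 1 k').2.2).resolve_right hx
  exact ⟨g, hg, k, hk, by simp [hs]⟩

end Module

end IsAmalgam

section CentralPairing

variable {G L : Type*} [Group G] [Group L] {π : L →* G}

theorem commutatorElement_map_left_mem_center {z : L} (hz : π z ∈ Subgroup.center G)
    (hker : π.ker = Subgroup.center L) (l : L) : ⁅z, l⁆ ∈ Subgroup.center L := by
  rw [← hker, MonoidHom.mem_ker, map_commutatorElement]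
  exact commutatorElement_eq_one_of_left_mem_center hz _

theorem exists_centralPairing (hπ : Function.Surjective π) (hker : π.ker = Subgroup.center L) :
    ∃ θ : Subgroup.center G →* G →* Subgroup.center L, Function.Injective θ ∧
      ∀ (z : Subgroup.center G) (l l' : L), π l = z → (θ z (π l') : L) = ⁅l, l'⁆ := by
  let Z := (Subgroup.center G).comap π
  let β : Z →* L →* Subgroup.center L := commutatorPairing Z.subtype (MonoidHom.id L)
    fun z l => commutatorElement_map_left_mem_center z.2 hker l
  have hZ : Function.Surjective (π.subgroupComap (Subgroup.center G)) :=
    π.subgroupComap_surjective_of_surjective _ hπ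
  let γ : G →* Z →* Subgroup.center L := π.liftOfSurjective hπ ⟨β.flip, fun l hl => by
    ext z
    exact commutatorElement_eq_one_of_right_mem_center (hker.le hl) z.1⟩
  have γ_apply (l : L) : γ (π l) = β.flip l := MonoidHom.liftOfRightInverse_comp_apply _ _ _ _ l
  let θ : Subgroup.center G →* G →* Subgroup.center L :=
    (π.subgroupComap (Subgroup.center G)).liftOfSurjective hZ ⟨γ.flip, fun z hz => by
      ext g
      obtain ⟨l, rfl⟩ := hπ g
      rw [MonoidHom.flip_apply, γ_apply]
      exact commutatorElement_eq_one_of_left_mem_center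
        (hker.le (congrArg Subtype.val hz)) l⟩
  have θ_apply (z : Z) : θ (π.subgroupComap (Subgroup.center G) z) = γ.flip z :=
    MonoidHom.liftOfRightInverse_comp_apply _ _ _ _ z
  have coe_θ (z : Subgroup.center G) (l l' : L) (h : π l = z) : (θ z (π l') : L) = ⁅l, l'⁆ := by
    rw [← show π.subgroupComap (Subgroup.center G) ⟨l, Subgroup.mem_comap.2 (h ▸ z.2)⟩ = z from
      Subtype.ext h, θ_apply, MonoidHom.flip_apply, γ_apply]
    rfl
  refine ⟨θ, (injective_iff_map_eq_one θ).2 fun z hz => ?_, coe_θ⟩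
  obtain ⟨l, hl⟩ := hπ z
  have central : l ∈ Subgroup.center L := Subgroup.mem_center_iff.2 fun l' => by
    refine (commutatorElement_eq_one_iff_mul_comm.1 ?_).symm
    rw [← coe_θ z l l' hl, hz]
    rfl
  exact Subtype.ext (hl.symm.trans (hker.ge central))

end CentralPairing

/-- The twist over a central extension `π : L → G`, untwisted on `L`, for a quadratic map `T` with
values in the characters of `G` in the centre of `L`. -/
def WreathTwist.ofCover {L G K : Type*} [Group L] [Group G] [Group K] {π : L →* G}
    (hπ : Function.Surjective π) (hker : π.ker ≤ Subgroup.center L)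
    (T : QuadraticHom K (G →* Subgroup.center L)) :
    WreathTwist L G K L (Subgroup.center L) where
  π := π
  π_surjective := hπ
  α := MonoidHom.id L
  α_mem_center _ hl := hker hl
  T := T
  ι := (Subgroup.center L).subtype
  ι_mem_center c := c.2

namespace IsAmalgam

open Monoid (Coprod)

variable {G : Type u} {K : Type v} {P : Type (max u v)} {H : Type*} [Group G] [Group K] [Group P]
  [Group H] {a : H →* G} {b : H →* K} {inl : G →* P} {inr : K →* P}

section Cover

variable {L : Type u} [Group L] {π : L →* G} {θ : Subgroup.center G →* G →* Subgroup.center L}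

theorem quadraticHom_apply_eq_of_mem_epicenter (hP : IsAmalgam a b inl inr)
    (hG : ClassAtMostTwo G) (hK : ClassAtMostTwo K) (ha : ∀ h, a h ∈ commutator G)
    (hb : ∀ h, b h ∈ commutator K) (hπ : Function.Surjective π)
    (hker : π.ker ≤ Subgroup.center L)
    (hθ : ∀ (z : Subgroup.center G) (l l' : L), π l = z → (θ z (π l') : L) = ⁅l, l'⁆)
    {T : QuadraticHom K (G →* Subgroup.center L)}
    (hT : ∀ h, T (b h) = θ ⟨a h, hG.commutator_le_center (ha h)⟩) {g : Subgroup.center G} {k : K}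
    (hz : inl g * inr k ∈ epicenter P) : T k = (θ g)⁻¹ := by
  let D := WreathTwist.ofCover hπ hker T
  obtain ⟨Ψ, hΨl, hΨr⟩ := hP.exists_hom_wreathTwist hG hK D ha hb fun h l l' hl => by
    change ((T (b h) (π l') : Subgroup.center L) : L) = ⁅l, l'⁆
    rw [hT, hθ _ _ _ hl]
  obtain ⟨l, hl⟩ := hπ g
  have Ψ_eq : Ψ (inl g * inr k) = (Coprod.inl l * Coprod.inr k : Coprod L K) := by
    rw [map_mul, hΨr, ← hl]
    exact congrArg (· * _) (hΨl l)
  ext g'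
  obtain ⟨l', rfl⟩ := hπ g'
  have commute_rep := commute_of_mem_epicenter Ψ hz Ψ_eq (hΨl l')
  rw [map_mul, D.rep_inl, D.rep_inl, D.rep_inr,
    TranslationWreath.commute_inl_mul_inr_inl] at commute_rep
  have mul_eq : l * (l' * T k (π l')) = l' * l := by
    simpa [D, WreathTwist.base_apply, WreathTwist.ofCover] using commute_rep 1
  rw [MonoidHom.inv_apply, InvMemClass.coe_inv, hθ g l l' hl, commutatorElement_inv,
    ← mul_left_inj (l * l'), ← mul_eq_commutatorElement_mul, ← mul_eq,
    ← Subgroup.mem_center_iff.1 (T k (π l')).2, mul_assoc]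

theorem exists_quadraticHom_apply_eq {p : ℕ} [Fact p.Prime] (hodd : Odd p)
    (hG : ClassAtMostTwo G) (hK : ClassAtMostTwo K) (hGp : ∀ x : G, x ^ p = 1)
    (hKp : ∀ x : K, x ^ p = 1) (hb_inj : Function.Injective b) (ha : ∀ h, a h ∈ commutator G)
    (hb : ∀ h, b h ∈ commutator K) (θ : Subgroup.center G →* G →* Subgroup.center L) {k : K}
    (hk : k ∉ b.range) (v : G →* Subgroup.center L) :
    ∃ T : QuadraticHom K (G →* Subgroup.center L),
      (∀ h, T (b h) = θ ⟨a h, hG.commutator_le_center (ha h)⟩) ∧ T k = v := by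
  let e : H ≃* b.range := MonoidHom.ofInjective hb_inj
  have range_le : b.range ≤ Subgroup.center K := by
    rintro _ ⟨h, rfl⟩
    exact hK.commutator_le_center (hb h)
  have pow_eq_one (f : G →* Subgroup.center L) : f ^ p = 1 := by
    ext g
    rw [MonoidHom.pow_apply, ← map_pow, hGp, map_one, MonoidHom.one_apply]
  obtain ⟨T, hT, hTk⟩ := QuadraticHom.exists_extend_of_notMem hodd hK hKp pow_eq_one range_le
    ((θ.comp (a.codRestrict _ fun h => hG.commutator_le_center (ha h))).comp e.symm.toMonoidHom)
    hk v
  refine ⟨T, fun h => (hT (e h)).trans ?_, hTk⟩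
  exact congrArg (θ.comp (a.codRestrict _ _)) (e.symm_apply_apply h)

theorem mul_eq_one_of_mem_epicenter {p : ℕ} [Fact p.Prime] (hP : IsAmalgam a b inl inr)
    (hodd : Odd p) (hG : ClassAtMostTwo G) (hK : ClassAtMostTwo K) (hGp : ∀ x : G, x ^ p = 1)
    (hKp : ∀ x : K, x ^ p = 1) [Nontrivial (Subgroup.center G)]
    (hb_inj : Function.Injective b) (ha : ∀ h, a h ∈ commutator G) (hb : ∀ h, b h ∈ commutator K)
    (hK' : commutator K ≠ ⊤) (hπ : Function.Surjective π) (hker : π.ker = Subgroup.center L)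
    {g : G} (hg : g ∈ Subgroup.center G) {k : K} (hz : inl g * inr k ∈ epicenter P) :
    inl g * inr k = 1 := by
  obtain ⟨θ, hθ_inj, hθ⟩ := exists_centralPairing hπ hker
  lift g to Subgroup.center G using hg
  have T_apply {T : QuadraticHom K (G →* Subgroup.center L)} :=
    hP.quadraticHom_apply_eq_of_mem_epicenter hG hK ha hb hπ hker.le hθ (T := T) (hz := hz)
  have exists_T {k' : K} := exists_quadraticHom_apply_eq (k := k') hodd hG hK hGp hKp hb_inj ha hb θ
  have := hθ_inj.nontrivial
  obtain ⟨h, rfl⟩ : k ∈ b.range := by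
    by_contra hk
    obtain ⟨v, hv⟩ := exists_ne (θ g)⁻¹
    obtain ⟨T, hT, hTk⟩ := exists_T hk v
    exact hv (hTk.symm.trans (T_apply hT))
  have range_le : b.range ≤ commutator K := by
    rintro _ ⟨h, rfl⟩
    exact hb h
  obtain ⟨k₀, hk₀⟩ := SetLike.exists_not_mem_of_ne_top _ hK' rfl
  obtain ⟨T, hT, -⟩ := exists_T (fun hk => hk₀ (range_le hk)) 1
  have g_eq : g = (⟨a h, hG.commutator_le_center (ha h)⟩ : Subgroup.center G)⁻¹ := hθ_inj <| by
    rw [map_inv, ← hT, T_apply hT, inv_inv]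
  rw [g_eq, ← hP.comm, InvMemClass.coe_inv, map_inv, inv_mul_cancel]

end Cover

theorem capable {p : ℕ} [Fact p.Prime] (hP : IsAmalgam a b inl inr) (hodd : Odd p)
    (hG : ClassAtMostTwo G) (hK : ClassAtMostTwo K) (hGp : ∀ x : G, x ^ p = 1)
    (hKp : ∀ x : K, x ^ p = 1) [Nontrivial H] (ha_inj : Function.Injective a)
    (hb_inj : Function.Injective b) (ha : ∀ h, a h ∈ commutator G) (hb : ∀ h, b h ∈ commutator K)
    (hcap : Capable G) : Capable P := by
  obtain ⟨L, _, ⟨e⟩⟩ := hcap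
  let π : L →* G := e.symm.toMonoidHom.comp (QuotientGroup.mk' _)
  have hπ : Function.Surjective π := e.symm.surjective.comp (QuotientGroup.mk'_surjective _)
  have hker : π.ker = Subgroup.center L :=
    (MonoidHom.ker_mulEquiv_comp _ e.symm).trans (QuotientGroup.ker_mk' _)
  obtain ⟨h, hh⟩ := exists_ne (1 : H)
  have hG' : commutator G ≠ ⊥ := fun hbot =>
    hh (ha_inj (by rw [map_one, ← Subgroup.mem_bot, ← hbot]; exact ha h))
  have hK' : commutator K ≠ ⊥ := fun hbot =>
    hh (hb_inj (by rw [map_one, ← Subgroup.mem_bot, ← hbot]; exact hb h))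
  have : Nontrivial (Subgroup.center G) := by
    rw [Subgroup.nontrivial_iff_ne_bot]
    exact ne_bot_of_le_ne_bot hG' hG.commutator_le_center
  let _ : Module (ZMod p) (Additive (Abelianization G)) :=
    AddCommGroup.zmodModule (abelianization_nsmul_eq_zero hGp)
  let _ : Module (ZMod p) (Additive (Abelianization K)) :=
    AddCommGroup.zmodModule (abelianization_nsmul_eq_zero hKp)
  refine Capable.of_epicenter_eq_bot ((Subgroup.eq_bot_iff_forall _).2 fun z hz => ?_)
  obtain ⟨g, hg, k, -, rfl⟩ := hP.exists_mem_commutator_of_mem_epicenter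
    (hodd.ne_two_of_dvd_nat dvd_rfl) hG hK ha hb (hG.commutator_ne_top hG')
    (hK.commutator_ne_top hK') hz
  exact hP.mul_eq_one_of_mem_epicenter hodd hG hK hGp hKp hb_inj ha hb (hK.commutator_ne_top hK')
    hπ hker (hG.commutator_le_center hg) hz

end IsAmalgam

theorem mainTheorem12 (p : ℕ) (hp : p.Prime) (hodd : Odd p)
    (G : Type u) (K : Type v) [Group G] [Group K]
    (hG : ClassAtMostTwo G) (hK : ClassAtMostTwo K)
    (hGp : Monoid.exponent G = p) (hKp : Monoid.exponent K = p)
    (hGna : ∃ x y : G, x * y ≠ y * x) (hKna : ∃ x y : K, x * y ≠ y * x)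
    (H : Subgroup G) (hH : H ≤ commutator G) (hHnt : H ≠ ⊥)
    (φ : H →* commutator K) (hφ : Function.Injective φ)
    (hcap : Capable G ∨ Capable K) :
    Capable (AmalgamatedCoproduct H φ) := by
  have : Fact p.Prime := ⟨hp⟩
  have : Nontrivial H := H.nontrivial_iff_ne_bot.2 hHnt
  have pow_G (x : G) : x ^ p = 1 := hGp ▸ Monoid.pow_exponent_eq_one x
  have pow_K (x : K) : x ^ p = 1 := hKp ▸ Monoid.pow_exponent_eq_one x
  have hP := AmalgamatedCoproduct.isAmalgam H φ
  have inj_K : Function.Injective ((commutator K).subtype.comp φ) :=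
    Subtype.val_injective.comp hφ
  have mem_G (h : H) : H.subtype h ∈ commutator G := hH h.2
  have mem_K (h : H) : (commutator K).subtype.comp φ h ∈ commutator K := (φ h).2
  rcases hcap with hcap | hcap
  · exact hP.capable hodd hG hK pow_G pow_K H.subtype_injective inj_K mem_G mem_K hcap
  · exact hP.symm.capable hodd hK hG pow_K pow_G inj_K H.subtype_injective mem_K mem_G hcap
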